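/- Let $G=(V,E)$ be a finite connected simple graph with at least two vertices, write $v\sim u$ if $v$ and $u$ are adjacent and $v\nsim u$ otherwise (so $v\nsim v$), and let $0<\alpha\le\beta$. For $\mathbf{x}=(x_v)_{v\in V}\in\mathbb{Z}_+^V$ put $$\Gamma_v(\mathbf{x})=\exp\Big(\alpha x_v+\beta\sum_{u\sim v}x_u\Big),\quad v\in V,\qquad \Gamma(\mathbf{x})=\sum_{v\in V}\Gamma_v(\mathbf{x}).$$ Let $X(n)=(X_v(n))_{v\in V}$, $n\ge 0$, be the growth process with parameters $(\alpha,\beta)$ on $G$, that is, the discrete-time Markov chain on $\mathbb{Z}_+^V$ which moves from $\mathbf{x}$ to $\mathbf{x}+\mathbf{e}_v$ with probability $\Gamma_v(\mathbf{x})/\Gamma(\mathbf{x})$, $v\in V$, where $\mathbf{e}_v$ is the $v$-th unit vector. Then, for every initial state $X(0)=\mathbf{x}\in\mathbb{Z}_+^V$, with probability one there exists a random set $U\subseteq V$ inducing a maximal clique of $G$ (a complete induced subgraph that is not contained in a larger one) such that $$\lim_{n\to\infty}X_v(n)=\infty\ \text{ if and only if }\ v\in U,$$ and $$\lim_{n\to\infty}\frac{X_v(n)}{X_u(n)}=e^{C_{vu}}\quad\text{for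 } v,u\in U,$$ where, for $v,u\in U$, if $\alpha=\beta=:\lambda$, the (random, finite) limit $$C_{vu}=\lambda\lim_{n\to\infty}\sum_{w\in V\setminus\{v,u\}}X_w(n)\big[\mathbf{1}_{\{w\sim v,\,w\nsim u\}}-\mathbf{1}_{\{w\sim u,\,w\nsim v\}}\big]$$ exists, and $C_{vu}=0$ if $\alpha<\beta$. -/

import Mathlib

open MeasureTheory Filter Topology

noncomputable section

/-- The growth rate `Γ_v(x) = exp (α x_v + β ∑_{u ∼ v} x_u)`. -/
def growthRate {V : Type*} [Fintype V] (G : SimpleGraph V) [DecidableRel G.Adj]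
    (α β : ℝ) (x : V → ℕ) (v : V) : ℝ :=
  Real.exp (α * (x v : ℝ) + β * ∑ u with G.Adj v u, (x u : ℝ))

/-- The probability `Γ_v(x) / ∑_w Γ_w(x)` that, in state `x`, the next particle is allocated
at the vertex `v`. -/
def allocProb {V : Type*} [Fintype V] (G : SimpleGraph V) [DecidableRel G.Adj]
    (α β : ℝ) (x : V → ℕ) (v : V) : ℝ :=
  growthRate G α β x v / ∑ w, growthRate G α β x w

/-- `X` is, on the probability space `(Ω, P)`, a discrete-time Markov chain with state space
`V → ℕ` which moves from a state `x` to `x + e_v` with probability `Γ_v(x) / Γ(x)`: the growth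
process with parameters `(α, β)` on `G`. The Markov property with these transition
probabilities is stated without division by the probability of the past:
`P(X_0 = x_0, …, X_n = x_n, X_{n+1} = x_n + e_v)
  = (Γ_v(x_n) / Γ(x_n)) P(X_0 = x_0, …, X_n = x_n)`.
(Since these probabilities sum to one over `v`, all other transitions have probability zero.) -/
structure IsGrowthProcess {V : Type*} [Fintype V] [DecidableEq V] (G : SimpleGraph V)
    [DecidableRel G.Adj] (α β : ℝ) {Ω : Type*} [MeasurableSpace Ω] (P : Measure Ω)
    (X : ℕ → Ω → V → ℕ) : Prop where
  measurable : ∀ n, Measurable (X n)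
  transition : ∀ (n : ℕ) (x : ℕ → V → ℕ) (v : V),
    P {ω | (∀ i ≤ n, X i ω = x i) ∧ X (n + 1) ω = x n + Pi.single v 1} =
      ENNReal.ofReal (allocProb G α β (x n) v) * P {ω | ∀ i ≤ n, X i ω = x i}

/-- The number of particles, in state `x`, at the vertices other than `v`, `u` that are adjacent
to `v` and not to `u`, minus the number of those at the vertices other than `v`, `u` that are
adjacent to `u` and not to `v`. -/
def neighbourDiff {V : Type*} [Fintype V] [DecidableEq V] (G : SimpleGraph V)
    [DecidableRel G.Adj] (x : V → ℕ) (v u : V) : ℝ :=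
  ∑ w with w ≠ v ∧ w ≠ u, (x w : ℝ) *
    ((if G.Adj w v ∧ ¬ G.Adj w u then 1 else 0) - (if G.Adj w u ∧ ¬ G.Adj w v then 1 else 0))

end

/-! From any state, choose a maximal clique `K` greedily by log-rate, so that each `w ∉ K` has a
non-neighbour `u ∈ K` with at least the same log-rate. As long as particles fall only in `K`, one at
`u` lowers the log-rate of `w` relative to `u` by `α`, and one elsewhere in `K` does not raise it,
because it gives `u` a gain of `β` and `w` at most `β`. The probability of leaving `K` is thus
controlled by geometrically decaying terms, each spent when its vertex receives a particle. A
bounded potential turns this into a lower bound, uniform over all states, for the probability of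
never leaving `K` (`Dominated.potential_le_sum`, `le_measure_steps_mem`). By Lévy's zero-one law the
process almost surely ends up in one maximal clique (`ae_localized`).

Once inside a clique, `neighbourDiff` is frozen, and the log-ratio of two rates is `(α - β) (x v - x
u) + β D` with `D` constant. The strong law for bounded martingale differences replaces allocations
by their conditional probabilities up to `o(n)`. If `α = β`, the ratio of the probabilities is
constant; if `α < β`, imbalances are pushed back. Either way `x v - c * x u = o(n)`
(`tendsto_sub_exp_mul_div`), and since the total over `K` grows like `n`, all limits follow. -/

/-- For every weight `f` there is a maximal clique `K` such that every vertex outside `K` has a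
non-neighbour in `K` of at least the same weight. -/
theorem SimpleGraph.exists_maximal_clique_dominating {V : Type*} [Fintype V] [DecidableEq V]
    (G : SimpleGraph V) [DecidableRel G.Adj] (f : V → ℝ) :
    ∃ K : Finset V, Maximal G.IsClique (K : Set V) ∧
      ∀ w ∉ K, ∃ u ∈ K, ¬ G.Adj w u ∧ f w ≤ f u := by
  have greedy : ∀ S : Finset V, ∃ K ⊆ S, G.IsClique (K : Set V) ∧
      ∀ w ∈ S, w ∉ K → ∃ u ∈ K, ¬ G.Adj w u ∧ f w ≤ f u := by
    intro S
    induction S using Finset.strongInduction with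
    | H S ih =>
      rcases S.eq_empty_or_nonempty with rfl | hS
      · exact ⟨∅, by simp, by simp, by simp⟩
      -- Keep a heaviest vertex and recurse on its neighbours in `S`; every vertex discarded here is
      -- a non-neighbour of `v` of no larger weight.
      obtain ⟨v, hv, hmax⟩ := S.exists_max_image f hS
      obtain ⟨K, hKS, hK, hdom⟩ := ih (S.filter (G.Adj v)) (by
        refine Finset.filter_ssubset.2 ⟨v, hv, by simp⟩)
      refine ⟨insert v K, ?_, ?_, ?_⟩
      · exact Finset.insert_subset hv (hKS.trans (Finset.filter_subset _ _))
      · rw [Finset.coe_insert, SimpleGraph.isClique_insert]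
        exact ⟨hK, fun u hu _ => (Finset.mem_filter.1 (hKS hu)).2⟩
      · intro w hw hwK
        rw [Finset.mem_insert, not_or] at hwK
        by_cases h : G.Adj v w
        · obtain ⟨u, hu, h1, h2⟩ := hdom w (Finset.mem_filter.2 ⟨hw, h⟩) hwK.2
          exact ⟨u, Finset.mem_insert_of_mem hu, h1, h2⟩
        · exact ⟨v, Finset.mem_insert_self _ _, fun h' => h h'.symm, hmax w hw⟩
  obtain ⟨K, -, hK, hdom⟩ := greedy Finset.univ
  refine ⟨K, ⟨hK, fun T hT hKT w hw => ?_⟩, fun w hw => hdom w (Finset.mem_univ _) hw⟩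
  by_contra hwK
  obtain ⟨u, hu, h, -⟩ := hdom w (Finset.mem_univ _) hwK
  exact h (hT hw (hKT hu) (by rintro rfl; exact hwK hu))

/-! ### Log-rates and allocation probabilities. -/

section Rates

variable {V : Type*} [Fintype V] (G : SimpleGraph V) [DecidableRel G.Adj]
  (α β : ℝ)

/-- The logarithm of the growth rate. -/
def logRate (x : V → ℕ) (v : V) : ℝ :=
  α * (x v : ℝ) + β * ∑ u with G.Adj v u, (x u : ℝ)

theorem growthRate_eq_exp (x : V → ℕ) (v : V) :
    growthRate G α β x v = Real.exp (logRate G α β x v) := rfl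

theorem sum_growthRate_pos [Nonempty V] (x : V → ℕ) : 0 < ∑ w, growthRate G α β x w :=
  Finset.sum_pos (fun _ _ => Real.exp_pos _) Finset.univ_nonempty

theorem allocProb_nonneg (x : V → ℕ) (v : V) : 0 ≤ allocProb G α β x v :=
  div_nonneg (Real.exp_pos _).le (Finset.sum_nonneg fun _ _ => (Real.exp_pos _).le)

theorem sum_allocProb [Nonempty V] (x : V → ℕ) : ∑ v, allocProb G α β x v = 1 := by
  simp only [allocProb]
  rw [← Finset.sum_div, div_self (sum_growthRate_pos G α β x).ne']

theorem allocProb_le_one [Nonempty V] (x : V → ℕ) (v : V) : allocProb G α β x v ≤ 1 := by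
  rw [← sum_allocProb G α β x]
  exact Finset.single_le_sum (fun w _ => allocProb_nonneg G α β x w) (Finset.mem_univ v)

theorem allocProb_eq_exp_mul (x : V → ℕ) (v u : V) :
    allocProb G α β x v =
      Real.exp (logRate G α β x v - logRate G α β x u) * allocProb G α β x u := by
  simp only [allocProb, growthRate_eq_exp, Real.exp_sub]
  field_simp

variable [DecidableEq V]

theorem logRate_add_single (x : V → ℕ) (v w : V) :
    logRate G α β (x + Pi.single v 1) w =
      logRate G α β x w + (if w = v then α else 0) + (if G.Adj w v then β else 0) := by
  have h : ∑ u with G.Adj w u, ((Pi.single v 1 : V → ℕ) u : ℝ) =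
      if G.Adj w v then 1 else 0 := by
    simp [Pi.single_apply]
  have h' : (((Pi.single v 1 : V → ℕ) w : ℕ) : ℝ) = if w = v then 1 else 0 := by
    simp [Pi.single_apply]
  simp only [logRate, Pi.add_apply, Nat.cast_add, Finset.sum_add_distrib, h, h']
  split_ifs <;> ring

theorem sum_eq_add_add_sum_ne {v u : V} (h : v ≠ u) (F : V → ℝ) :
    ∑ w, F w = F v + F u + ∑ w with w ≠ v ∧ w ≠ u, F w := by
  rw [← Finset.sum_erase_add _ _ (Finset.mem_univ v),
    ← Finset.sum_erase_add (Finset.univ.erase v) _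
      (Finset.mem_erase.2 ⟨h.symm, Finset.mem_univ u⟩)]
  have : (Finset.univ.erase v).erase u = Finset.univ.filter fun w => w ≠ v ∧ w ≠ u := by
    ext w; simp [and_comm]
  rw [this]; ring

theorem neighbourDiff_eq_sum (x : V → ℕ) (v u : V) :
    neighbourDiff G x v u = ∑ w with w ≠ v ∧ w ≠ u,
      (x w : ℝ) * ((if G.Adj v w then 1 else 0) - (if G.Adj u w then 1 else 0)) := by
  refine Finset.sum_congr rfl fun w _ => ?_
  by_cases hv : G.Adj v w <;> by_cases hu : G.Adj u w <;> simp [G.adj_comm w, hv, hu]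

theorem neighbourDiff_self (x : V → ℕ) (v : V) : neighbourDiff G x v v = 0 := by
  simp [neighbourDiff]

/-- Adjacent vertices count each other with weight `β` and themselves with weight `α`, hence the
coefficient `α - β`; common neighbours cancel. -/
theorem logRate_sub_logRate (x : V → ℕ) {v u : V} (h : G.Adj v u) :
    logRate G α β x v - logRate G α β x u =
      (α - β) * ((x v : ℝ) - x u) + β * neighbourDiff G x v u := by
  have key : ∑ w, (x w : ℝ) * ((if G.Adj v w then 1 else 0) - (if G.Adj u w then 1 else 0)) =
      x u - x v + neighbourDiff G x v u := by
    rw [neighbourDiff_eq_sum, sum_eq_add_add_sum_ne h.ne]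
    simp [h, h.symm]; ring
  have hsum : ∀ a, ∑ w with G.Adj a w, (x w : ℝ) =
      ∑ w, (x w : ℝ) * (if G.Adj a w then 1 else 0) := fun a => by
    simp [Finset.sum_filter]
  simp only [mul_sub, Finset.sum_sub_distrib] at key
  simp only [logRate, hsum]
  linear_combination β * key

end Rates

/-! ### The bounded potential. -/

section Potential

/-- The product `∏_{j < k} (1 + c r ^ j)`. -/
def damping (c r : ℝ) (k : ℕ) : ℝ := ∏ j ∈ Finset.range k, (1 + c * r ^ j)

theorem damping_succ (c r : ℝ) (k : ℕ) :
    damping c r (k + 1) = damping c r k * (1 + c * r ^ k) := Finset.prod_range_succ _ _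

theorem damping_pos {c r : ℝ} (hc : 0 ≤ c) (hr : 0 ≤ r) (k : ℕ) : 0 < damping c r k :=
  Finset.prod_pos fun _ _ => by positivity

theorem damping_le {c r : ℝ} (hc : 0 ≤ c) (hr : 0 ≤ r) (hr1 : r < 1) (k : ℕ) :
    damping c r k ≤ Real.exp (c * (1 - r)⁻¹) := by
  calc damping c r k ≤ ∏ j ∈ Finset.range k, Real.exp (c * r ^ j) :=
        Finset.prod_le_prod (fun _ _ => by positivity)
          fun j _ => by rw [add_comm]; exact Real.add_one_le_exp _
    _ = Real.exp (c * ∑ j ∈ Finset.range k, r ^ j) := by rw [← Real.exp_sum, Finset.mul_sum]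
    _ ≤ _ := by
      have h : ∑ j ∈ Finset.range k, r ^ j ≤ (1 - r)⁻¹ := by
        rw [← tsum_geometric_of_lt_one hr hr1]
        exact (summable_geometric_of_lt_one hr hr1).sum_le_tsum _ fun _ _ => by positivity
      gcongr

variable {V : Type*} [Fintype V] {α : ℝ}

/-- The potential of the state `y`, relative to the state `b`. -/
noncomputable def potential (α : ℝ) (K : Finset V) (b y : V → ℕ) : ℝ :=
  ∏ u ∈ K, damping (Fintype.card V) (Real.exp (-α)) (y u - b u)

theorem potential_self (K : Finset V) (b : V → ℕ) : potential α K b b = 1 := by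
  simp [potential, damping]

theorem potential_pos (K : Finset V) (b y : V → ℕ) : 0 < potential α K b y :=
  Finset.prod_pos fun _ _ => damping_pos (by positivity) (by positivity) _

/-- An upper bound for the potential. -/
noncomputable def potentialBound (V : Type*) [Fintype V] (α : ℝ) : ℝ :=
  Real.exp (Fintype.card V * (1 - Real.exp (-α))⁻¹) ^ Fintype.card V

theorem potential_le (hα : 0 < α) (K : Finset V) (b y : V → ℕ) :
    potential α K b y ≤ potentialBound V α := by
  have hr : Real.exp (-α) < 1 := by simpa using hα
  calc potential α K b y
      ≤ ∏ _u ∈ K, Real.exp (Fintype.card V * (1 - Real.exp (-α))⁻¹) :=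
        Finset.prod_le_prod (fun _ _ => (damping_pos (by positivity) (by positivity) _).le)
          fun _ _ => damping_le (by positivity) (by positivity) hr _
    _ ≤ potentialBound V α := by
        rw [Finset.prod_const, potentialBound]
        -- Passing from `K.card` to the number of all vertices makes the bound independent of the
        -- clique.
        refine pow_le_pow_right₀ (Real.one_le_exp ?_) (Finset.card_le_univ K)
        have : 0 ≤ 1 - Real.exp (-α) := by linarith
        positivity

theorem potentialBound_pos (V : Type*) [Fintype V] (α : ℝ) : 0 < potentialBound V α := by
  unfold potentialBound; positivity

end Potential

/-! ### Domination by a clique, and the submartingale inequality. -/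

section Dominated

variable {V : Type*} [Fintype V] [DecidableEq V] (G : SimpleGraph V) [DecidableRel G.Adj]
  (α β : ℝ)

/-- Every vertex outside `K` has a non-neighbour in `K` whose growth rate dominates its own by a
factor exponential in the number of particles added there since the state `b`. -/
structure Dominated (K : Finset V) (b y : V → ℕ) : Prop where
  le : ∀ v ∈ K, b v ≤ y v
  exists_nonadj : ∀ w ∉ K, ∃ u ∈ K, ¬ G.Adj w u ∧
    logRate G α β y w - logRate G α β y u ≤ -α * ((y u - b u : ℕ) : ℝ)

variable {G α β}

/-- The witness `u` of each `w` never changes: a particle at `u` gains `α` for `u` and nothing for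
`w`, and one at another vertex of the clique gains `β` for `u` and at most `β` for `w`. -/
theorem Dominated.add_single {K : Finset V} {b y : V → ℕ} (hα : 0 < α) (hαβ : α ≤ β)
    (hK : G.IsClique (K : Set V)) (h : Dominated G α β K b y) {v : V} (hv : v ∈ K) :
    Dominated G α β K b (y + Pi.single v 1) := by
  refine ⟨fun w hw => (h.le w hw).trans (by simp), fun w hw => ?_⟩
  obtain ⟨u, hu, hwu, hle⟩ := h.exists_nonadj w hw
  refine ⟨u, hu, hwu, ?_⟩
  have hwv : w ≠ v := by rintro rfl; exact hw hv
  rw [logRate_add_single, logRate_add_single, if_neg hwv]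
  have hb := h.le u hu
  rcases eq_or_ne u v with rfl | huv
  · have : (y + Pi.single u 1 : V → ℕ) u - b u = (y u - b u) + 1 := by simp; omega
    rw [this, if_neg hwu]
    push_cast
    simp
    linarith
  · have : (y + Pi.single v 1 : V → ℕ) u - b u = y u - b u := by simp [huv]
    have huv' : G.Adj u v := hK hu hv huv
    rw [this, if_neg huv, if_pos huv']
    split_ifs <;> linarith

theorem potential_add_single {K : Finset V} {b y : V → ℕ} {v : V} (hv : v ∈ K)
    (hb : b v ≤ y v) :
    potential α K b (y + Pi.single v 1) =
      potential α K b y * (1 + Fintype.card V * Real.exp (-α) ^ (y v - b v)) := by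
  have h1 : (y + Pi.single v 1 : V → ℕ) v - b v = (y v - b v) + 1 := by simp; omega
  rw [potential, potential, ← Finset.mul_prod_erase K _ hv, ← Finset.mul_prod_erase K _ hv, h1,
    damping_succ]
  have h2 : ∏ u ∈ K.erase v, damping (Fintype.card V) (Real.exp (-α))
      ((y + Pi.single v 1 : V → ℕ) u - b u) =
      ∏ u ∈ K.erase v, damping (Fintype.card V) (Real.exp (-α)) (y u - b u) :=
    Finset.prod_congr rfl fun u hu => by simp [Finset.ne_of_mem_erase hu]
  rw [h2]; ring

/-- The potential is a submartingale for the process killed on leaving `K`: the factor `1 + card V *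
exp (-α) ^ k` gained by a step at `v` compensates exactly for the bound on the escape probability.
-/
theorem Dominated.potential_le_sum [Nonempty V] {K : Finset V} {b y : V → ℕ}
    (h : Dominated G α β K b y) :
    potential α K b y ≤
      ∑ v ∈ K, allocProb G α β y v * potential α K b (y + Pi.single v 1) := by
  set p := allocProb G α β y
  set e : V → ℝ := fun v => Real.exp (-α) ^ (y v - b v)
  have hp : ∀ v, 0 ≤ p v := allocProb_nonneg G α β y
  have hout : ∀ w ∈ Kᶜ, p w ≤ ∑ v ∈ K, e v * p v := by
    intro w hw
    obtain ⟨u, hu, -, hle⟩ := h.exists_nonadj w (Finset.mem_compl.1 hw)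
    calc p w = _ := allocProb_eq_exp_mul G α β y w u
      _ ≤ e u * p u := by
        refine mul_le_mul_of_nonneg_right ?_ (hp u)
        simp only [e]
        rw [← Real.exp_nat_mul]
        exact Real.exp_le_exp.2 (hle.trans_eq (by ring))
      _ ≤ _ := Finset.single_le_sum (f := fun v => e v * p v)
        (fun v _ => mul_nonneg (by positivity) (hp v)) hu
  have hnn : 0 ≤ ∑ v ∈ K, e v * p v :=
    Finset.sum_nonneg fun v _ => mul_nonneg (by positivity) (hp v)
  have hsum : ∑ w ∈ Kᶜ, p w ≤ Fintype.card V * ∑ v ∈ K, e v * p v := by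
    refine (Finset.sum_le_card_nsmul _ _ _ hout).trans ?_
    rw [nsmul_eq_mul]
    gcongr
    exact Finset.card_le_univ _
  have hone : 1 ≤ ∑ v ∈ K, p v + Fintype.card V * ∑ v ∈ K, e v * p v := by
    rw [← sum_allocProb G α β y, ← Finset.sum_add_sum_compl K]
    gcongr
  calc potential α K b y
      ≤ potential α K b y * (∑ v ∈ K, p v + Fintype.card V * ∑ v ∈ K, e v * p v) :=
        le_mul_of_one_le_right (potential_pos K b y).le hone
    _ = ∑ v ∈ K, p v * potential α K b (y + Pi.single v 1) := by
      rw [Finset.mul_sum, ← Finset.sum_add_distrib, Finset.mul_sum]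
      refine Finset.sum_congr rfl fun v hv => ?_
      rw [potential_add_single hv (h.le v hv)]
      ring

end Dominated

/-! ### Deterministic drift criterion for `o(n)`. -/

theorem eventually_le_of_drift {Y R : ℕ → ℝ} {B c : ℝ} {N : ℕ}
    (hR : Tendsto (fun n : ℕ => R n / n) atTop (𝓝 0))
    (hc : ∀ n ≥ N, Y (n + 1) - Y n ≤ c)
    (hdrift : ∀ n ≥ N, B ≤ Y n → Y (n + 1) - Y n ≤ R (n + 1) - R n) {ε : ℝ} (hε : 0 < ε) :
    ∀ᶠ n : ℕ in atTop, Y n / n ≤ ε := by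
  have hR' : ∀ᶠ n : ℕ in atTop, |R n| ≤ ε / 3 * n := by
    filter_upwards [hR.abs.eventually_lt_const (u := ε / 3) (by simpa using by positivity),
      eventually_gt_atTop 0] with n hn h0
    have : (0 : ℝ) < n := by exact_mod_cast h0
    rw [abs_div, Nat.abs_cast, div_lt_iff₀ this] at hn
    exact hn.le
  obtain ⟨N₁, hN₁⟩ := (hR'.and (eventually_ge_atTop N)).exists_forall_of_atTop
  -- Above level `B` the difference `Y - R` does not increase; from below `B` one step reaches at
  -- most `B + c`, at the cost of `|R|`, which is at most `ε / 3 * n`.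
  set A := max (Y N₁ - R N₁) (B + c)
  have hbound : ∀ n ≥ N₁, Y n - R n ≤ A + ε / 3 * n := by
    intro n hn
    induction n, hn using Nat.le_induction with
    | base =>
      have : Y N₁ - R N₁ ≤ A := le_max_left _ _
      have : 0 ≤ ε / 3 * (N₁ : ℝ) := by positivity
      linarith
    | succ n hn ih =>
      push_cast
      rcases le_or_gt B (Y n) with h | h
      · have := hdrift n (hN₁ n hn).2 h
        linarith
      · have h1 := hc n (hN₁ n hn).2
        have h2 := neg_abs_le (R (n + 1))
        have h3 := (hN₁ (n + 1) (by omega)).1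
        have h4 : B + c ≤ A := le_max_right _ _
        push_cast at h3
        linarith
  have hA : Tendsto (fun n : ℕ => A / n) atTop (𝓝 0) := tendsto_const_div_atTop_nhds_zero_nat A
  filter_upwards [hA.eventually_lt_const (u := ε / 3) (by positivity), eventually_ge_atTop N₁,
    eventually_gt_atTop 0] with n h1 h2 h0
  have hn : (0 : ℝ) < n := by exact_mod_cast h0
  rw [div_lt_iff₀ hn] at h1
  rw [div_le_iff₀ hn]
  have := hbound n h2
  have := le_abs_self (R n)
  have := (hN₁ n h2).1
  linarith

/-- A real sequence with bounded increments whose increments are, up to those of a sequence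
`R n = o(n)`, directed towards a bounded interval is `o(n)`. -/
theorem tendsto_div_zero_of_drift {Y R : ℕ → ℝ} {B c : ℝ} {N : ℕ}
    (hR : Tendsto (fun n : ℕ => R n / n) atTop (𝓝 0))
    (hc : ∀ n ≥ N, |Y (n + 1) - Y n| ≤ c)
    (hpos : ∀ n ≥ N, B ≤ Y n → Y (n + 1) - Y n ≤ R (n + 1) - R n)
    (hneg : ∀ n ≥ N, Y n ≤ -B → R (n + 1) - R n ≤ Y (n + 1) - Y n) :
    Tendsto (fun n : ℕ => Y n / n) atTop (𝓝 0) := by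
  rw [Metric.tendsto_nhds]
  intro ε hε
  have h1 := eventually_le_of_drift hR (fun n hn => (abs_le.1 (hc n hn)).2) hpos (half_pos hε)
  have h2 := eventually_le_of_drift (Y := fun n => -Y n) (R := fun n => -R n) (B := B) (c := c)
    (N := N) (by simpa [neg_div] using hR.neg)
    (fun n hn => by linarith [(abs_le.1 (hc n hn)).1])
    (fun n hn hB => by linarith [hneg n hn (by linarith)]) (half_pos hε)
  filter_upwards [h1, h2] with n h1 h2
  rw [Real.dist_eq, sub_zero, abs_lt]
  rw [neg_div] at h2
  constructor <;> linarith

/-! ### Paths whose steps stay in a fixed set. -/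

section Step

variable {V : Type*} [DecidableEq V] {K : Finset V} {x : ℕ → V → ℕ} {N : ℕ}

theorem add_single_one_inj {y : V → ℕ} {v u : V} :
    y + Pi.single v 1 = y + Pi.single u 1 ↔ v = u := by
  refine ⟨fun h => ?_, fun h => h ▸ rfl⟩
  by_contra hne
  have := congrFun (add_left_cancel h) v
  simp [hne] at this

theorem abs_increment_le {x : ℕ → V → ℕ} {n : ℕ} (h : ∃ z, x (n + 1) = x n + Pi.single z 1)
    (v : V) : |(x (n + 1) v : ℝ) - x n v| ≤ 1 := by
  obtain ⟨z, hz⟩ := h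
  rcases eq_or_ne z v with rfl | hne
  · simp [hz]
  · simp [hz, hne.symm]

theorem apply_eq_of_step_mem (hstep : ∀ n ≥ N, ∃ z ∈ K, x (n + 1) = x n + Pi.single z 1)
    {w : V} (hw : w ∉ K) {n : ℕ} (hn : N ≤ n) : x n w = x N w := by
  induction n, hn using Nat.le_induction with
  | base => rfl
  | succ n hn ih =>
    obtain ⟨z, hz, h⟩ := hstep n hn
    have : w ≠ z := by rintro rfl; exact hw hz
    simp [h, this, ih]

theorem sum_eq_of_step_mem (hstep : ∀ n ≥ N, ∃ z ∈ K, x (n + 1) = x n + Pi.single z 1)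
    {n : ℕ} (hn : N ≤ n) :
    ∑ v ∈ K, (x n v : ℝ) = n + (∑ v ∈ K, (x N v : ℝ) - N) := by
  induction n, hn using Nat.le_induction with
  | base => ring
  | succ n hn ih =>
    obtain ⟨z, hz, h⟩ := hstep n hn
    have : ∑ v ∈ K, ((Pi.single z 1 : V → ℕ) v : ℝ) = 1 := by
      simp [Pi.single_apply, hz]
    simp only [h, Pi.add_apply, Nat.cast_add, Finset.sum_add_distrib, ih, this]
    push_cast; ring

end Step

/-! ### Asymptotics of a path confined to a clique. -/

section Path

variable {V : Type*} [Fintype V] [DecidableEq V] {G : SimpleGraph V} [DecidableRel G.Adj]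
  {α β : ℝ}

/-- A vertex of the clique other than `v` and `u` is adjacent to both, so its weight in the sum is
zero. -/
theorem neighbourDiff_add_single {K : Set V} (hK : G.IsClique K) (y : V → ℕ) {v u z : V}
    (hv : v ∈ K) (hu : u ∈ K) (hz : z ∈ K) :
    neighbourDiff G (y + Pi.single z 1) v u = neighbourDiff G y v u := by
  refine Finset.sum_congr rfl fun w hw => ?_
  obtain ⟨hwv, hwu⟩ := (Finset.mem_filter.1 hw).2
  rcases eq_or_ne w z with rfl | hwz
  · simp [hK hz hv hwv, hK hz hu hwu]
  · simp [hwz]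

variable (G α β) in
/-- The martingale part of the number of particles allocated at `v` before time `n`. -/
noncomputable def allocNoise (x : ℕ → V → ℕ) (v : V) (n : ℕ) : ℝ :=
  ∑ i ∈ Finset.range n,
    ((if x (i + 1) = x i + Pi.single v 1 then 1 else 0) - allocProb G α β (x i) v)

theorem increment_eq_noise_add {x : ℕ → V → ℕ} {n : ℕ} (h : ∃ z, x (n + 1) = x n + Pi.single z 1)
    (v : V) : (x (n + 1) v : ℝ) - x n v =
      (allocNoise G α β x v (n + 1) - allocNoise G α β x v n) + allocProb G α β (x n) v := by
  obtain ⟨z, hz⟩ := h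
  rw [allocNoise, allocNoise, Finset.sum_range_succ, hz]
  simp only [add_single_one_inj]
  rcases eq_or_ne z v with rfl | hne
  · simp
  · simp [hne, hne.symm]

variable {K : Finset V} {x : ℕ → V → ℕ} {N : ℕ}

theorem neighbourDiff_eq_of_step_mem (hK : G.IsClique (K : Set V))
    (hstep : ∀ n ≥ N, ∃ z ∈ K, x (n + 1) = x n + Pi.single z 1) {v u : V} (hv : v ∈ K)
    (hu : u ∈ K) {n : ℕ} (hn : N ≤ n) :
    neighbourDiff G (x n) v u = neighbourDiff G (x N) v u := by
  induction n, hn using Nat.le_induction with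
  | base => rfl
  | succ n hn ih =>
    obtain ⟨z, hz, h⟩ := hstep n hn
    rw [h, neighbourDiff_add_single hK _ hv hu hz, ih]

variable (G α β) in
/-- The logarithm of the asymptotic ratio of the numbers of particles at `v` and `u` for a path
that stays in a clique from the state `y` on. -/
noncomputable def limitLogRatio (y : V → ℕ) (v u : V) : ℝ :=
  if α = β then α * neighbourDiff G y v u else 0

/-- The drift of `x v - c * x u` is `(exp (log-rate difference) - c)` times the probability of `u`.
It vanishes if `α = β`; if `α < β`, then `c = 1` and it opposes the sign of `x v - x u` outside a
bounded interval. -/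
theorem tendsto_sub_exp_mul_div (hαβ : α ≤ β) (hK : G.IsClique (K : Set V))
    (hstep : ∀ n ≥ N, ∃ z ∈ K, x (n + 1) = x n + Pi.single z 1)
    (hnoise : ∀ v, Tendsto (fun n : ℕ => allocNoise G α β x v n / n) atTop (𝓝 0))
    {v u : V} (hv : v ∈ K) (hu : u ∈ K) :
    Tendsto (fun n : ℕ => ((x n v : ℝ) - Real.exp (limitLogRatio G α β (x N) v u) * x n u) / n)
      atTop (𝓝 0) := by
  rcases eq_or_ne v u with rfl | hne
  · simp [limitLogRatio, neighbourDiff_self]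
  have hadj : G.Adj v u := hK hv hu hne
  set c := Real.exp (limitLogRatio G α β (x N) v u) with hc
  have hc0 : 0 < c := Real.exp_pos _
  set D := neighbourDiff G (x N) v u with hD
  have hlog : ∀ n ≥ N, logRate G α β (x n) v - logRate G α β (x n) u =
      (α - β) * ((x n v : ℝ) - x n u) + β * D := fun n hn => by
    rw [logRate_sub_logRate G α β (x n) hadj, neighbourDiff_eq_of_step_mem hK hstep hv hu hn]
  have hstep' : ∀ n ≥ N, ∃ z, x (n + 1) = x n + Pi.single z 1 := fun n hn =>
    (hstep n hn).imp fun z hz => hz.2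
  have hinc : ∀ n ≥ N, ((x (n + 1) v : ℝ) - c * x (n + 1) u) - (x n v - c * x n u) =
      ((allocNoise G α β x v (n + 1) - c * allocNoise G α β x u (n + 1)) -
        (allocNoise G α β x v n - c * allocNoise G α β x u n)) +
        (allocProb G α β (x n) v - c * allocProb G α β (x n) u) := fun n hn => by
    linear_combination increment_eq_noise_add (G := G) (α := α) (β := β) (hstep' n hn) v -
      c * increment_eq_noise_add (G := G) (α := α) (β := β) (hstep' n hn) u
  -- `B` is where the restoring term `(β - α) |x v - x u|` outweighs `|β * D|`. For `α = β` division
  -- by zero gives `B = 0`, which is harmless as the drift is then zero.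
  refine tendsto_div_zero_of_drift (N := N) (c := 1 + c) (B := |β * D| / (β - α))
    (Y := fun n => (x n v : ℝ) - c * x n u)
    (R := fun n => allocNoise G α β x v n - c * allocNoise G α β x u n) ?_ ?_ ?_ ?_
  · have := (hnoise v).sub ((hnoise u).const_mul c)
    simp only [mul_zero, sub_zero] at this
    refine this.congr fun n => by ring
  · intro n hn
    have h1 := abs_increment_le (hstep' n hn) v
    have h2 := mul_le_mul_of_nonneg_left (abs_increment_le (hstep' n hn) u) hc0.le
    rw [abs_le] at h1
    have h3 := abs_le.1 (abs_increment_le (hstep' n hn) u)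
    rw [abs_le]
    constructor <;> nlinarith
  · intro n hn hB
    rw [hinc n hn, allocProb_eq_exp_mul G α β (x n) v u, hlog n hn, ← sub_mul]
    have : Real.exp ((α - β) * ((x n v : ℝ) - x n u) + β * D) ≤ c := by
      rw [hc, Real.exp_le_exp, limitLogRatio]
      split_ifs with h
      · simp [h, hD]
      · have hlt : 0 < β - α := sub_pos.2 (lt_of_le_of_ne hαβ h)
        have hc1 : c = 1 := by simp [hc, limitLogRatio, h]
        rw [div_le_iff₀ hlt, hc1] at hB
        linarith [le_abs_self (β * D)]
    have := mul_nonneg (sub_nonneg.2 this) (allocProb_nonneg G α β (x n) u)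
    linarith
  · intro n hn hB
    rw [hinc n hn, allocProb_eq_exp_mul G α β (x n) v u, hlog n hn, ← sub_mul]
    have : c ≤ Real.exp ((α - β) * ((x n v : ℝ) - x n u) + β * D) := by
      rw [hc, Real.exp_le_exp, limitLogRatio]
      split_ifs with h
      · simp [h, hD]
      · have hlt : 0 < β - α := sub_pos.2 (lt_of_le_of_ne hαβ h)
        have hc1 : c = 1 := by simp [hc, limitLogRatio, h]
        rw [le_neg, div_le_iff₀ hlt, hc1] at hB
        linarith [neg_abs_le (β * D)]
    have := mul_nonneg (sub_nonneg.2 this) (allocProb_nonneg G α β (x n) u)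
    linarith

/-- Summing `x v = c v * x u + o(n)` over `K` gives `n + O(1)`, so the limit is the inverse of `∑ v
∈ K, c v`. -/
theorem exists_tendsto_div (hαβ : α ≤ β) (hK : G.IsClique (K : Set V))
    (hstep : ∀ n ≥ N, ∃ z ∈ K, x (n + 1) = x n + Pi.single z 1)
    (hnoise : ∀ v, Tendsto (fun n : ℕ => allocNoise G α β x v n / n) atTop (𝓝 0))
    {u : V} (hu : u ∈ K) :
    ∃ ρ > 0, Tendsto (fun n : ℕ => (x n u : ℝ) / n) atTop (𝓝 ρ) := by
  set c : V → ℝ := fun v => Real.exp (limitLogRatio G α β (x N) v u) with hc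
  have hS : 0 < ∑ v ∈ K, c v := Finset.sum_pos (fun _ _ => Real.exp_pos _) ⟨u, hu⟩
  refine ⟨(∑ v ∈ K, c v)⁻¹, inv_pos.2 hS, ?_⟩
  have h1 := tendsto_finsetSum K fun v hv =>
    tendsto_sub_exp_mul_div hαβ hK hstep hnoise hv hu
  rw [Finset.sum_const_zero] at h1
  have h2 := ((tendsto_const_div_atTop_nhds_zero_nat
    (∑ v ∈ K, (x N v : ℝ) - N)).const_add 1).sub h1 |>.mul_const (∑ v ∈ K, c v)⁻¹
  simp only [add_zero, sub_zero, one_mul] at h2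
  refine h2.congr' ?_
  filter_upwards [eventually_ge_atTop N, eventually_gt_atTop 0] with n hn h0
  have h0' : (n : ℝ) ≠ 0 := by exact_mod_cast h0.ne'
  have := sum_eq_of_step_mem hstep hn
  rw [← Finset.sum_div, Finset.sum_sub_distrib, ← Finset.sum_mul, this]
  field_simp
  ring

theorem tendsto_atTop_of_mem (hαβ : α ≤ β) (hK : G.IsClique (K : Set V))
    (hstep : ∀ n ≥ N, ∃ z ∈ K, x (n + 1) = x n + Pi.single z 1)
    (hnoise : ∀ v, Tendsto (fun n : ℕ => allocNoise G α β x v n / n) atTop (𝓝 0))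
    {u : V} (hu : u ∈ K) : Tendsto (fun n => x n u) atTop atTop := by
  obtain ⟨ρ, hρ, h⟩ := exists_tendsto_div hαβ hK hstep hnoise hu
  rw [← tendsto_natCast_atTop_iff (R := ℝ)]
  refine (h.pos_mul_atTop hρ tendsto_natCast_atTop_atTop).congr' ?_
  filter_upwards [eventually_gt_atTop 0] with n h0
  have h0' : (n : ℝ) ≠ 0 := by exact_mod_cast h0.ne'
  field_simp

theorem tendsto_atTop_iff_mem (hαβ : α ≤ β) (hK : G.IsClique (K : Set V))
    (hstep : ∀ n ≥ N, ∃ z ∈ K, x (n + 1) = x n + Pi.single z 1)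
    (hnoise : ∀ v, Tendsto (fun n : ℕ => allocNoise G α β x v n / n) atTop (𝓝 0))
    {u : V} : Tendsto (fun n => x n u) atTop atTop ↔ u ∈ K := by
  refine ⟨fun h => ?_, tendsto_atTop_of_mem hαβ hK hstep hnoise⟩
  by_contra hu
  obtain ⟨n, hn, hN⟩ := ((h.eventually_gt_atTop (x N u)).and (eventually_ge_atTop N)).exists
  exact hn.ne' (apply_eq_of_step_mem hstep hu hN)

theorem tendsto_ratio (hαβ : α ≤ β) (hK : G.IsClique (K : Set V))
    (hstep : ∀ n ≥ N, ∃ z ∈ K, x (n + 1) = x n + Pi.single z 1)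
    (hnoise : ∀ v, Tendsto (fun n : ℕ => allocNoise G α β x v n / n) atTop (𝓝 0))
    {v u : V} (hv : v ∈ K) (hu : u ∈ K) :
    Tendsto (fun n => (x n v : ℝ) / x n u) atTop
      (𝓝 (Real.exp (limitLogRatio G α β (x N) v u))) := by
  obtain ⟨ρ, hρ, h⟩ := exists_tendsto_div hαβ hK hstep hnoise hu
  have h1 := ((tendsto_sub_exp_mul_div hαβ hK hstep hnoise hv hu).div h hρ.ne').const_add
    (Real.exp (limitLogRatio G α β (x N) v u))
  rw [zero_div, add_zero] at h1
  refine h1.congr' ?_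
  filter_upwards [eventually_gt_atTop 0,
    (tendsto_atTop_of_mem hαβ hK hstep hnoise hu).eventually_gt_atTop 0] with n h0 hu0
  have h0' : (n : ℝ) ≠ 0 := by exact_mod_cast h0.ne'
  have hu0' : (x n u : ℝ) ≠ 0 := by exact_mod_cast hu0.ne'
  simp only [Pi.div_apply]
  field_simp
  ring

end Path

/-! ### Strong law for bounded martingale differences. -/

/-- From `k ^ 2` up to the next square there are at most `2 * k` unit steps, negligible against `k ^
2`. -/
theorem tendsto_div_of_tendsto_div_sq {S : ℕ → ℝ} (hS : ∀ n, |S (n + 1) - S n| ≤ 1)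
    (h : Tendsto (fun k : ℕ => S (k ^ 2) / (k : ℝ) ^ 2) atTop (𝓝 0)) :
    Tendsto (fun n : ℕ => S n / n) atTop (𝓝 0) := by
  have hinc : ∀ m k, |S (m + k)| ≤ |S m| + k := by
    intro m k
    induction k with
    | zero => simp
    | succ k ih =>
      have h1 := hS (m + k)
      have h2 := abs_sub_abs_le_abs_sub (S (m + k + 1)) (S (m + k))
      rw [← add_assoc]
      push_cast
      linarith
  have hsqrt : Tendsto Nat.sqrt atTop atTop :=
    tendsto_atTop_atTop.2 fun b => ⟨b * b, fun n hn => Nat.le_sqrt.2 hn⟩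
  have hlim : Tendsto (fun n : ℕ => |S (n.sqrt ^ 2) / (n.sqrt : ℝ) ^ 2| + 2 / (n.sqrt : ℝ))
      atTop (𝓝 0) := by
    have := (h.abs.add (tendsto_const_div_atTop_nhds_zero_nat (2 : ℝ))).comp hsqrt
    simp only [abs_zero, add_zero] at this
    exact this
  refine squeeze_zero_norm' ?_ hlim
  filter_upwards [eventually_gt_atTop 0] with n hn
  set k := n.sqrt
  have hk : 0 < k := Nat.sqrt_pos.2 hn
  have hkn : k ^ 2 ≤ n := Nat.sqrt_le' n
  have hnk : n - k ^ 2 ≤ 2 * k := by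
    have : n ≤ k * k + k + k := Nat.sqrt_le_add n
    rw [pow_two]; omega
  have h1 : |S n| ≤ |S (k ^ 2)| + 2 * k := by
    have h1 := hinc (k ^ 2) (n - k ^ 2)
    rw [Nat.add_sub_cancel' hkn] at h1
    have : ((n - k ^ 2 : ℕ) : ℝ) ≤ 2 * k := by exact_mod_cast hnk
    linarith
  have hk' : (0 : ℝ) < k := by exact_mod_cast hk
  have hkn' : (k : ℝ) ^ 2 ≤ n := by exact_mod_cast hkn
  rw [Real.norm_eq_abs, abs_div, abs_div, Nat.abs_cast, abs_of_pos (pow_pos hk' 2)]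
  calc |S n| / n ≤ (|S (k ^ 2)| + 2 * k) / (k : ℝ) ^ 2 := by gcongr
    _ = _ := by field_simp

section LargeNumbers

variable {Ω : Type*} {m0 : MeasurableSpace Ω} {P : Measure Ω} [IsProbabilityMeasure P]
  {ℱ : Filtration ℕ m0} {D : ℕ → Ω → ℝ}

theorem integral_sq_sum_le (hmeas : ∀ i, StronglyMeasurable[ℱ (i + 1)] (D i))
    (hb : ∀ i ω, |D i ω| ≤ 1) (hD : ∀ i, P[D i | ℱ i] =ᵐ[P] 0) (n : ℕ) :
    Integrable (fun ω => (∑ i ∈ Finset.range n, D i ω) ^ 2) P ∧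
      ∫ ω, (∑ i ∈ Finset.range n, D i ω) ^ 2 ∂P ≤ n := by
  have hSm : ∀ n, StronglyMeasurable[ℱ n] (fun ω => ∑ i ∈ Finset.range n, D i ω) := fun n =>
    Finset.stronglyMeasurable_fun_sum _ fun i hi =>
      (hmeas i).mono (ℱ.mono (Finset.mem_range.1 hi))
  have hSb : ∀ n ω, |∑ i ∈ Finset.range n, D i ω| ≤ n := fun n ω => by
    refine (Finset.abs_sum_le_sum_abs _ _).trans ?_
    simpa using Finset.sum_le_sum (s := Finset.range n) fun i _ => hb i ω
  have hDm : ∀ i, StronglyMeasurable (D i) := fun i => (hmeas i).mono (ℱ.le _)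
  have hDint : ∀ i, Integrable (D i) P := fun i =>
    Integrable.of_bound (hDm i).aestronglyMeasurable 1 (ae_of_all _ fun ω => hb i ω)
  have hD2int : ∀ i, Integrable (fun ω => D i ω ^ 2) P := fun i =>
    Integrable.of_bound ((hDm i).pow 2).aestronglyMeasurable 1 (ae_of_all _ fun ω => by
      rw [Real.norm_eq_abs, abs_pow]
      exact pow_le_one₀ (abs_nonneg _) (hb i ω))
  induction n with
  | zero => simp
  | succ n ih =>
    have hSm' := (hSm n).mono (ℱ.le n)
    -- Orthogonality of martingale differences: the cross term has zero mean, so variances add.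
    have hcross : P[(fun ω => ∑ i ∈ Finset.range n, D i ω) * D n | ℱ n] =ᵐ[P] 0 := by
      refine (condExp_stronglyMeasurable_mul_of_bound (ℱ.le n) (hSm n) (hDint n) n
        (ae_of_all _ fun ω => hSb n ω)).trans ?_
      filter_upwards [hD n] with ω hω
      simp [hω]
    have hcross0 : ∫ ω, (∑ i ∈ Finset.range n, D i ω) * D n ω ∂P = 0 := by
      have h := integral_condExp (μ := P) (ℱ.le n)
        (f := (fun ω => ∑ i ∈ Finset.range n, D i ω) * D n)
      rw [integral_congr_ae hcross] at h
      simpa using h.symm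
    have hcint : Integrable (fun ω => (∑ i ∈ Finset.range n, D i ω) * D n ω) P :=
      (hDint n).bdd_mul (c := n) hSm'.aestronglyMeasurable (ae_of_all _ fun ω => hSb n ω)
    have heq : ∀ ω, (∑ i ∈ Finset.range (n + 1), D i ω) ^ 2 =
        (∑ i ∈ Finset.range n, D i ω) ^ 2 + 2 * ((∑ i ∈ Finset.range n, D i ω) * D n ω) +
          D n ω ^ 2 := fun ω => by rw [Finset.sum_range_succ]; ring
    simp only [heq]
    refine ⟨(ih.1.add (hcint.const_mul 2)).add (hD2int n), ?_⟩
    have hsum : Integrable (fun ω => (∑ i ∈ Finset.range n, D i ω) ^ 2 +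
        2 * ((∑ i ∈ Finset.range n, D i ω) * D n ω)) P := ih.1.add (hcint.const_mul 2)
    rw [integral_add hsum (hD2int n), integral_add ih.1 (hcint.const_mul 2),
      integral_const_mul, hcross0]
    have : ∫ ω, D n ω ^ 2 ∂P ≤ ∫ _ω, (1 : ℝ) ∂P :=
      integral_mono (hD2int n) (integrable_const _) fun ω => by
        rw [← sq_abs]
        exact pow_le_one₀ (abs_nonneg _) (hb n ω)
    simp at this
    push_cast
    linarith [ih.2]

/-- The strong law of large numbers for bounded martingale differences. -/
theorem ae_tendsto_sum_div_of_condExp_eq_zero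
    (hmeas : ∀ i, StronglyMeasurable[ℱ (i + 1)] (D i)) (hb : ∀ i ω, |D i ω| ≤ 1)
    (hD : ∀ i, P[D i | ℱ i] =ᵐ[P] 0) :
    ∀ᵐ ω ∂P, Tendsto (fun n : ℕ => (∑ i ∈ Finset.range n, D i ω) / n) atTop (𝓝 0) := by
  set S : ℕ → Ω → ℝ := fun n ω => ∑ i ∈ Finset.range n, D i ω
  have hSm : ∀ n, Measurable (S n) := fun n =>
    Finset.measurable_fun_sum _ fun i _ => ((hmeas i).mono (ℱ.le _)).measurable
  have hfm : ∀ k : ℕ, Measurable fun ω => ENNReal.ofReal ((S (k ^ 2) ω / (k : ℝ) ^ 2) ^ 2) :=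
    fun k => (((hSm _).div_const _).pow_const 2).ennreal_ofReal
  have hle : ∀ k : ℕ, ∫⁻ ω, ENNReal.ofReal ((S (k ^ 2) ω / (k : ℝ) ^ 2) ^ 2) ∂P ≤
      ENNReal.ofReal (1 / (k : ℝ) ^ 2) := by
    intro k
    obtain ⟨h1, h2⟩ := integral_sq_sum_le hmeas hb hD (k ^ 2)
    have heq : ∀ ω, (S (k ^ 2) ω / (k : ℝ) ^ 2) ^ 2 = S (k ^ 2) ω ^ 2 / (k : ℝ) ^ 4 :=
      fun ω => by rw [div_pow]; ring
    simp only [heq]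
    rw [← ofReal_integral_eq_lintegral_ofReal (h1.div_const _)
      (ae_of_all _ fun ω => by positivity), integral_div]
    refine ENNReal.ofReal_le_ofReal ?_
    rcases k.eq_zero_or_pos with rfl | hk
    · simp
    have hk' : (0 : ℝ) < k := by exact_mod_cast hk
    rw [div_le_div_iff₀ (by positivity) (by positivity)]
    push_cast at h2
    nlinarith [mul_le_mul_of_nonneg_right h2 (by positivity : (0 : ℝ) ≤ (k : ℝ) ^ 2)]
  -- Along squares the second moments are at most `1 / k ^ 2`; a finite expected sum makes the terms
  -- tend to zero almost surely.
  have htsum : ∫⁻ ω, ∑' k : ℕ, ENNReal.ofReal ((S (k ^ 2) ω / (k : ℝ) ^ 2) ^ 2) ∂P ≠ ⊤ := by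
    rw [lintegral_tsum fun k => (hfm k).aemeasurable]
    refine ne_top_of_le_ne_top ?_ (ENNReal.tsum_le_tsum hle)
    exact (Real.summable_one_div_nat_pow.2 one_lt_two).tsum_ofReal_ne_top
  filter_upwards [ae_lt_top (Measurable.tsum hfm) htsum] with ω hω
  have h0 := ENNReal.tendsto_atTop_zero_of_tsum_ne_top hω.ne
  have h1 := (ENNReal.tendsto_toReal ENNReal.zero_ne_top).comp h0
  have h2 : Tendsto (fun k : ℕ => (S (k ^ 2) ω / (k : ℝ) ^ 2) ^ 2) atTop (𝓝 0) :=
    h1.congr fun k => ENNReal.toReal_ofReal (sq_nonneg _)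
  have h3 := h2.sqrt
  simp only [Real.sqrt_sq_eq_abs, Real.sqrt_zero] at h3
  refine tendsto_div_of_tendsto_div_sq (S := fun n => S n ω) (fun n => ?_)
    ((tendsto_zero_iff_abs_tendsto_zero _).2 h3)
  simpa [S, Finset.sum_range_succ] using hb n ω

end LargeNumbers

/-! ### Trajectories, the past filtration and step events. -/

section Past

variable {Ω E : Type*}

/-- The trajectory of a process up to time `n`. -/
def pathUpTo (X : ℕ → Ω → E) (n : ℕ) (ω : Ω) : Fin (n + 1) → E := fun i => X i ω

theorem pathUpTo_preimage_singleton (X : ℕ → Ω → E) {n : ℕ} (s : Fin (n + 1) → E) :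
    pathUpTo X n ⁻¹' {s} = {ω | ∀ i ≤ n, X i ω = s (Fin.ofNat (n + 1) i)} := by
  ext ω
  simp only [Set.mem_preimage, Set.mem_singleton_iff, Set.mem_ofPred_eq, funext_iff, pathUpTo]
  constructor
  · intro h i hi
    rw [← h]
    simp [Nat.mod_eq_of_lt (Nat.lt_succ_of_le hi)]
  · intro h i
    rw [h i (by omega)]
    simp

variable [MeasurableSpace E]

theorem measurable_of_le_comap_pathUpTo (X : ℕ → Ω → E) {i n : ℕ} (h : i ≤ n) :
    Measurable[MeasurableSpace.comap (pathUpTo X n) inferInstance] (X i) :=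
  (measurable_pi_apply (⟨i, by omega⟩ : Fin (n + 1))).comp (comap_measurable (pathUpTo X n))

variable [mΩ : MeasurableSpace Ω]

theorem measurable_pathUpTo {X : ℕ → Ω → E} (hX : ∀ n, Measurable (X n)) (n : ℕ) :
    Measurable (pathUpTo X n) := measurable_pi_lambda _ fun i => hX i

/-- The filtration of the past of a process. -/
def pastFiltration (X : ℕ → Ω → E) (hX : ∀ n, Measurable (X n)) : Filtration ℕ mΩ where
  seq n := MeasurableSpace.comap (pathUpTo X n) inferInstance
  mono' n m h := by
    refine measurable_iff_comap_le.1 (@measurable_pi_lambda _ _ _ (_) _ _ fun i => ?_)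
    exact measurable_of_le_comap_pathUpTo X (by omega)
  le' n := measurable_iff_comap_le.1 (measurable_pathUpTo hX n)

end Past

section StepEvents

variable {V Ω : Type*} [Finite V] [DecidableEq V] {mΩ : MeasurableSpace Ω} {X : ℕ → Ω → V → ℕ}

theorem measurableSet_step (hX : ∀ n, Measurable (X n)) (n : ℕ) (v : V) :
    MeasurableSet {ω | X (n + 1) ω = X n ω + Pi.single v 1} :=
  measurableSet_eq_fun (hX _) ((hX n).add_const _)

theorem measurableSet_exists_step_mem (hX : ∀ n, Measurable (X n)) (K : Finset V) (i : ℕ) :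
    MeasurableSet {ω | ∃ z ∈ K, X (i + 1) ω = X i ω + Pi.single z 1} := by
  have : {ω | ∃ z ∈ K, X (i + 1) ω = X i ω + Pi.single z 1} =
      ⋃ z ∈ K, {ω | X (i + 1) ω = X i ω + Pi.single z 1} := by ext; simp
  rw [this]
  exact Finset.measurableSet_biUnion _ fun z _ => measurableSet_step hX i z

theorem measurableSet_steps_mem_until (hX : ∀ n, Measurable (X n)) (K : Finset V) (n m : ℕ) :
    MeasurableSet {ω | ∀ i, n ≤ i → i < n + m →
      ∃ z ∈ K, X (i + 1) ω = X i ω + Pi.single z 1} := by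
  simp only [Set.ofPred_forall]
  exact MeasurableSet.iInter fun i => MeasurableSet.iInter fun _ => MeasurableSet.iInter fun _ =>
    measurableSet_exists_step_mem hX K i

theorem measurableSet_steps_mem (hX : ∀ n, Measurable (X n)) (K : Finset V) (n : ℕ) :
    MeasurableSet {ω | ∀ i ≥ n, ∃ z ∈ K, X (i + 1) ω = X i ω + Pi.single z 1} := by
  simp only [Set.ofPred_forall]
  exact MeasurableSet.iInter fun i => MeasurableSet.iInter fun _ =>
    measurableSet_exists_step_mem hX K i

end StepEvents

/-! ### Conditional law of a step, and vanishing noise. -/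

namespace IsGrowthProcess

variable {V : Type*} [Fintype V] [DecidableEq V] {G : SimpleGraph V}
  [DecidableRel G.Adj] {α β : ℝ} {Ω : Type*} [MeasurableSpace Ω] {P : Measure Ω}
  {X : ℕ → Ω → V → ℕ}

theorem measurableSet_past (hX : IsGrowthProcess G α β P X) (n : ℕ) (x : ℕ → V → ℕ) :
    MeasurableSet {ω | ∀ i ≤ n, X i ω = x i} := by
  simp only [Set.ofPred_forall]
  exact MeasurableSet.iInter fun i => MeasurableSet.iInter fun _ =>
    measurableSet_eq_fun (hX.measurable i) measurable_const

theorem measurable_allocProb (hX : IsGrowthProcess G α β P X) (n : ℕ) (v : V) :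
    Measurable fun ω => allocProb G α β (X n ω) v :=
  (Measurable.of_discrete (f := fun x : V → ℕ => allocProb G α β x v)).comp (hX.measurable n)

theorem measure_past_inter_step (hX : IsGrowthProcess G α β P X) (n : ℕ) (x : ℕ → V → ℕ) (v : V) :
    P ({ω | ∀ i ≤ n, X i ω = x i} ∩ {ω | X (n + 1) ω = X n ω + Pi.single v 1}) =
      ENNReal.ofReal (allocProb G α β (x n) v) * P {ω | ∀ i ≤ n, X i ω = x i} := by
  rw [← hX.transition]
  congr 1
  ext ω
  simp only [Set.mem_inter_iff, Set.mem_ofPred_eq]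
  refine and_congr_right fun h => ?_
  rw [h n le_rfl]

/-- Trajectories up to time `n` form a countable space, so two measures on it agree once they agree
on singletons, which is the transition property. -/
theorem measure_inter_eq_lintegral (hX : IsGrowthProcess G α β P X) [IsFiniteMeasure P] (n : ℕ)
    (v : V) {A : Set Ω} (hA : MeasurableSet[pastFiltration X hX.measurable n] A) :
    P (A ∩ {ω | X (n + 1) ω = X n ω + Pi.single v 1}) =
      ∫⁻ ω in A, ENNReal.ofReal (allocProb G α β (X n ω) v) ∂P := by
  obtain ⟨T, hT, rfl⟩ := hA
  have hH := measurable_pathUpTo hX.measurable n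
  have key : (P.restrict {ω | X (n + 1) ω = X n ω + Pi.single v 1}).map (pathUpTo X n) =
      (P.withDensity fun ω => ENNReal.ofReal (allocProb G α β (X n ω) v)).map (pathUpTo X n) := by
    refine Measure.ext_of_singleton fun s => ?_
    have hs : MeasurableSet (pathUpTo X n ⁻¹' {s}) := hH (measurableSet_singleton s)
    rw [Measure.map_apply hH (measurableSet_singleton s),
      Measure.map_apply hH (measurableSet_singleton s), Measure.restrict_apply hs,
      withDensity_apply _ hs]
    rw [pathUpTo_preimage_singleton] at hs ⊢
    rw [hX.measure_past_inter_step, setLIntegral_congr_fun (g := fun _ => ENNReal.ofReal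
      (allocProb G α β (s (Fin.ofNat (n + 1) n)) v)) hs (fun ω hω => by rw [hω n le_rfl]),
      setLIntegral_const]
  have := congrArg (fun ν => ν T) key
  simp only [Measure.map_apply hH hT] at this
  rwa [Measure.restrict_apply (hH hT), withDensity_apply _ (hH hT)] at this

theorem condExp_step [Nonempty V] [IsProbabilityMeasure P] (hX : IsGrowthProcess G α β P X)
    (n : ℕ) (v : V) :
    P[{ω | X (n + 1) ω = X n ω + Pi.single v 1}.indicator fun _ => (1 : ℝ) |
      pastFiltration X hX.measurable n] =ᵐ[P] fun ω => allocProb G α β (X n ω) v := by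
  have hle := (pastFiltration X hX.measurable).le n
  have hint : Integrable (fun ω => allocProb G α β (X n ω) v) P :=
    Integrable.of_bound (hX.measurable_allocProb n v).aestronglyMeasurable 1
      (ae_of_all _ fun ω => by
        rw [Real.norm_eq_abs, abs_of_nonneg (allocProb_nonneg G α β _ v)]
        exact allocProb_le_one G α β _ v)
  refine (ae_eq_condExp_of_forall_setIntegral_eq hle
    ((integrable_const _).indicator (measurableSet_step hX.measurable n v))
    (fun _ _ _ => hint.integrableOn)
    (fun A hA _ => ?_) ?_).symm
  · rw [integral_eq_lintegral_of_nonneg_ae (ae_of_all _ fun ω => allocProb_nonneg G α β _ v)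
      hint.aestronglyMeasurable.restrict, ← hX.measure_inter_eq_lintegral n v hA,
      setIntegral_indicator (measurableSet_step hX.measurable n v)]
    simp [Measure.real]
  · refine Measurable.aestronglyMeasurable ?_
    exact (Measurable.of_discrete (f := fun x : V → ℕ => allocProb G α β x v)).comp
      (measurable_of_le_comap_pathUpTo X le_rfl)

theorem ae_tendsto_allocNoise_div [Nonempty V] [IsProbabilityMeasure P]
    (hX : IsGrowthProcess G α β P X) :
    ∀ᵐ ω ∂P, ∀ v, Tendsto (fun n : ℕ => allocNoise G α β (fun i => X i ω) v n / n) atTop (𝓝 0) := by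
  rw [ae_all_iff]
  intro v
  have hdisc : ∀ i, Measurable[pastFiltration X hX.measurable i]
      (fun ω => allocProb G α β (X i ω) v) := fun i =>
    (Measurable.of_discrete (f := fun x : V → ℕ => allocProb G α β x v)).comp
      (measurable_of_le_comap_pathUpTo X le_rfl)
  have hp : ∀ i, Integrable (fun ω => allocProb G α β (X i ω) v) P := fun i =>
    Integrable.of_bound (hX.measurable_allocProb i v).aestronglyMeasurable 1
      (ae_of_all _ fun ω => by
        rw [Real.norm_eq_abs, abs_of_nonneg (allocProb_nonneg G α β _ v)]
        exact allocProb_le_one G α β _ v)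
  have hmeas : ∀ i, MeasurableSet[pastFiltration X hX.measurable (i + 1)]
      {ω | X (i + 1) ω = X i ω + Pi.single v 1} := fun i =>
    measurableSet_eq_fun (measurable_of_le_comap_pathUpTo X le_rfl)
      ((measurable_of_le_comap_pathUpTo X (Nat.le_succ i)).add_const _)
  have := ae_tendsto_sum_div_of_condExp_eq_zero (P := P) (ℱ := pastFiltration X hX.measurable)
    (D := fun i => ({ω | X (i + 1) ω = X i ω + Pi.single v 1}.indicator fun _ => (1 : ℝ)) -
      fun ω => allocProb G α β (X i ω) v) ?_ ?_ ?_
  · filter_upwards [this] with ω hω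
    exact hω.congr fun n => by simp [allocNoise, Set.indicator_apply]
  · intro i
    exact (stronglyMeasurable_const.indicator (hmeas i)).sub
      ((hdisc i).mono ((pastFiltration X hX.measurable).mono (Nat.le_succ i))
        le_rfl).stronglyMeasurable
  · intro i ω
    have h0 := allocProb_nonneg G α β (X i ω) v
    have h1 := allocProb_le_one G α β (X i ω) v
    by_cases h : X (i + 1) ω = X i ω + Pi.single v 1 <;> rw [abs_le] <;> simp [h] <;>
      constructor <;> linarith
  · intro i
    have h1 := condExp_sub (m := pastFiltration X hX.measurable i) (μ := P)
      ((integrable_const (1 : ℝ)).indicator (measurableSet_step hX.measurable i v)) (hp i)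
    have h2 := condExp_of_stronglyMeasurable ((pastFiltration X hX.measurable).le i)
      (hdisc i).stronglyMeasurable (hp i)
    filter_upwards [h1, hX.condExp_step i v] with ω h1 h3
    rw [h1, Pi.sub_apply, h2, h3]
    simp

end IsGrowthProcess

/-! ### Localization in a maximal clique. -/

namespace IsGrowthProcess

variable {V : Type*} [Fintype V] [DecidableEq V] {G : SimpleGraph V}
  [DecidableRel G.Adj] {α β : ℝ} {Ω : Type*} [MeasurableSpace Ω] {P : Measure Ω}
  {X : ℕ → Ω → V → ℕ}

/-- Induction on the horizon `m`: the normalized potential is at most one at the end and, by the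
submartingale inequality, at most its mean after one step within `K`. -/
theorem le_measure_steps_mem_until [Nonempty V] (hX : IsGrowthProcess G α β P X) (hα : 0 < α)
    (hαβ : α ≤ β) {K : Finset V} (hK : G.IsClique (K : Set V)) (b : V → ℕ) (m : ℕ) :
    ∀ (n : ℕ) (x : ℕ → V → ℕ), Dominated G α β K b (x n) →
      ENNReal.ofReal (potential α K b (x n) / potentialBound V α) * P {ω | ∀ i ≤ n, X i ω = x i} ≤
        P ({ω | ∀ i ≤ n, X i ω = x i} ∩ {ω | ∀ i, n ≤ i → i < n + m →
          ∃ z ∈ K, X (i + 1) ω = X i ω + Pi.single z 1}) := by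
  have hB := potentialBound_pos V α
  induction m with
  | zero =>
    intro n x _
    have hset : {ω | ∀ i, n ≤ i → i < n + 0 →
        ∃ z ∈ K, X (i + 1) ω = X i ω + Pi.single z 1} = Set.univ :=
      Set.eq_univ_of_forall fun ω i h1 h2 => by omega
    rw [hset, Set.inter_univ]
    refine mul_le_of_le_one_left zero_le ?_
    rw [ENNReal.ofReal_le_one, div_le_one hB]
    exact potential_le hα K b _
  | succ m ih =>
    intro n x hdom
    -- The history `x` continued by a step at `v`; its values after time `n + 1` play no role.
    set y : V → ℕ → V → ℕ := fun v => Function.update x (n + 1) (x n + Pi.single v 1) with hy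
    have hyn : ∀ v, y v (n + 1) = x n + Pi.single v 1 := fun v => by simp [hy]
    have hpast : ∀ v, {ω | ∀ i ≤ n + 1, X i ω = y v i} =
        {ω | (∀ i ≤ n, X i ω = x i) ∧ X (n + 1) ω = x n + Pi.single v 1} := fun v => by
      ext ω
      simp only [Set.mem_ofPred_eq]
      constructor
      · intro h
        refine ⟨fun i hi => ?_, by rw [h _ le_rfl, hyn]⟩
        rw [h i (by omega)]
        simp [hy, Function.update_of_ne (show i ≠ n + 1 by omega)]
      · rintro ⟨h1, h2⟩ i hi
        rcases eq_or_ne i (n + 1) with rfl | hne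
        · rw [h2, hyn]
        · rw [h1 i (by omega)]
          simp [hy, Function.update_of_ne hne]
    have hstep : ∀ v ∈ K, ENNReal.ofReal (allocProb G α β (x n) v *
        potential α K b (x n + Pi.single v 1) / potentialBound V α) *
          P {ω | ∀ i ≤ n, X i ω = x i} ≤
        P ({ω | ∀ i ≤ n + 1, X i ω = y v i} ∩ {ω | ∀ i, n + 1 ≤ i → i < n + 1 + m →
          ∃ z ∈ K, X (i + 1) ω = X i ω + Pi.single z 1}) := fun v hv => by
      refine le_trans (le_of_eq ?_) (ih (n + 1) (y v) (by
        rw [hyn]; exact hdom.add_single hα hαβ hK hv))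
      rw [hyn, hpast, hX.transition, ← mul_assoc, ← ENNReal.ofReal_mul (by
        have := potential_pos (α := α) K b (x n + Pi.single v 1); positivity)]
      congr 2
      ring
    calc ENNReal.ofReal (potential α K b (x n) / potentialBound V α) *
          P {ω | ∀ i ≤ n, X i ω = x i}
        ≤ (∑ v ∈ K, ENNReal.ofReal (allocProb G α β (x n) v *
            potential α K b (x n + Pi.single v 1) / potentialBound V α)) *
          P {ω | ∀ i ≤ n, X i ω = x i} := by
          gcongr
          rw [← ENNReal.ofReal_sum_of_nonneg fun v _ => div_nonneg (mul_nonneg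
            (allocProb_nonneg G α β _ v) (potential_pos K b _).le) hB.le, ← Finset.sum_div]
          exact ENNReal.ofReal_le_ofReal (by gcongr; exact hdom.potential_le_sum)
      _ ≤ ∑ v ∈ K, P ({ω | ∀ i ≤ n + 1, X i ω = y v i} ∩ {ω | ∀ i, n + 1 ≤ i → i < n + 1 + m →
          ∃ z ∈ K, X (i + 1) ω = X i ω + Pi.single z 1}) := by
          rw [Finset.sum_mul]
          exact Finset.sum_le_sum hstep
      _ = P (⋃ v ∈ K, ({ω | ∀ i ≤ n + 1, X i ω = y v i} ∩ {ω | ∀ i, n + 1 ≤ i → i < n + 1 + m →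
          ∃ z ∈ K, X (i + 1) ω = X i ω + Pi.single z 1})) := by
          rw [measure_biUnion_finset]
          · intro v _ u _ hvu
            rw [Function.onFun, Set.disjoint_left]
            rintro ω ⟨h1, -⟩ ⟨h2, -⟩
            have h := (h1 _ le_rfl).symm.trans (h2 _ le_rfl)
            rw [hyn, hyn] at h
            exact hvu (add_single_one_inj.1 h)
          · exact fun v _ => (hX.measurableSet_past _ _).inter
              (measurableSet_steps_mem_until hX.measurable K _ m)
      _ ≤ _ := by
          refine measure_mono (Set.iUnion₂_subset fun v hv => ?_)
          rintro ω ⟨h1, h2⟩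
          rw [hpast] at h1
          refine ⟨h1.1, fun i hi hi' => ?_⟩
          rcases eq_or_lt_of_le hi with rfl | hlt
          · exact ⟨v, hv, by rw [h1.2, h1.1 n le_rfl]⟩
          · exact h2 i hlt (by omega)

/-- With the current state as reference, the potential is `1`; letting the horizon grow gives a
constant depending on neither the history nor the clique. -/
theorem le_measure_steps_mem [Nonempty V] [IsFiniteMeasure P] (hX : IsGrowthProcess G α β P X)
    (hα : 0 < α) (hαβ : α ≤ β) (n : ℕ) (x : ℕ → V → ℕ) :
    ∃ K : Finset V, Maximal G.IsClique (K : Set V) ∧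
      ENNReal.ofReal (1 / potentialBound V α) * P {ω | ∀ i ≤ n, X i ω = x i} ≤
        P ({ω | ∀ i ≤ n, X i ω = x i} ∩
          {ω | ∀ i ≥ n, ∃ z ∈ K, X (i + 1) ω = X i ω + Pi.single z 1}) := by
  obtain ⟨K, hK, hdom⟩ := G.exists_maximal_clique_dominating (logRate G α β (x n))
  refine ⟨K, hK, ?_⟩
  have hdom' : Dominated G α β K (x n) (x n) := by
    refine ⟨fun _ _ => le_rfl, fun w hw => ?_⟩
    obtain ⟨u, hu, h1, h2⟩ := hdom w hw
    exact ⟨u, hu, h1, by simpa using h2⟩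
  have hge := fun m => hX.le_measure_steps_mem_until hα hαβ hK.prop (x n) m n x hdom'
  simp only [potential_self] at hge
  have hinter : {ω | ∀ i ≤ n, X i ω = x i} ∩
      {ω | ∀ i ≥ n, ∃ z ∈ K, X (i + 1) ω = X i ω + Pi.single z 1} =
      ⋂ m, ({ω | ∀ i ≤ n, X i ω = x i} ∩ {ω | ∀ i, n ≤ i → i < n + m →
          ∃ z ∈ K, X (i + 1) ω = X i ω + Pi.single z 1}) := by
    rw [← Set.inter_iInter]
    congr 1
    ext ω
    simp only [Set.mem_iInter, Set.mem_ofPred_eq]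
    exact ⟨fun h m i hi _ => h i hi, fun h i hi => h (i + 1) i hi (by omega)⟩
  rw [hinter]
  refine ge_of_tendsto' (tendsto_measure_iInter_atTop (fun m => ((hX.measurableSet_past n x).inter
    (measurableSet_steps_mem_until hX.measurable K n m)).nullMeasurableSet) ?_
      ⟨0, measure_ne_top _ _⟩) hge
  intro m m' hm ω hω
  exact ⟨hω.1, fun i h1 h2 => hω.2 i h1 (by omega)⟩

/-- The conditional probability of `L` given the past stays above `ε` and converges almost surely to
the indicator of `L`, which must therefore be `1`. -/
theorem ae_localized [Nonempty V] [IsProbabilityMeasure P] (hX : IsGrowthProcess G α β P X)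
    (hα : 0 < α) (hαβ : α ≤ β) :
    ∀ᵐ ω ∂P, ∃ K : Finset V, Maximal G.IsClique (K : Set V) ∧
      ∃ N, ∀ n ≥ N, ∃ z ∈ K, X (n + 1) ω = X n ω + Pi.single z 1 := by
  set L : Set Ω := ⋃ (K : Finset V) (_ : Maximal G.IsClique (K : Set V)) (N : ℕ),
    {ω | ∀ n ≥ N, ∃ z ∈ K, X (n + 1) ω = X n ω + Pi.single z 1} with hL
  have hLm : MeasurableSet L := MeasurableSet.iUnion fun K => MeasurableSet.iUnion fun _ =>
    MeasurableSet.iUnion fun N => measurableSet_steps_mem hX.measurable K N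
  set ε := 1 / potentialBound V α
  have hε : 0 < ε := one_div_pos.2 (potentialBound_pos V α)
  set ℱ := pastFiltration X hX.measurable
  have hlower : ∀ n (A : Set Ω), MeasurableSet[ℱ n] A → ENNReal.ofReal ε * P A ≤ P (A ∩ L) := by
    rintro n _ ⟨T, hT, rfl⟩
    have hH := measurable_pathUpTo hX.measurable n
    have h1 : P (pathUpTo X n ⁻¹' T ∩ L) = (P.restrict L).map (pathUpTo X n) T := by
      rw [Measure.map_apply hH hT, Measure.restrict_apply (hH hT)]
    have h2 : ENNReal.ofReal ε * P (pathUpTo X n ⁻¹' T) =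
        (ENNReal.ofReal ε • P.map (pathUpTo X n)) T := by
      rw [Measure.smul_apply, Measure.map_apply hH hT, smul_eq_mul]
    -- Decompose over the countably many histories: the clique varies with the history, but `ε` does
    -- not.
    rw [h1, h2, ← Measure.tsum_indicator_apply_singleton _ _ hT,
      ← Measure.tsum_indicator_apply_singleton _ _ hT]
    refine ENNReal.tsum_le_tsum fun s => Set.indicator_le_indicator ?_
    have hs := hH (measurableSet_singleton s)
    rw [Measure.smul_apply, Measure.map_apply hH (measurableSet_singleton s),
      Measure.map_apply hH (measurableSet_singleton s), Measure.restrict_apply hs, smul_eq_mul,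
      pathUpTo_preimage_singleton]
    obtain ⟨K, hK, h⟩ := hX.le_measure_steps_mem hα hαβ n fun i => s (Fin.ofNat (n + 1) i)
    refine h.trans (measure_mono (Set.inter_subset_inter_right _ fun ω hω => ?_))
    simp only [hL, Set.mem_iUnion]
    exact ⟨K, hK, n, hω⟩
  have hLint : Integrable (L.indicator fun _ => (1 : ℝ)) P := (integrable_const _).indicator hLm
  have hcond : ∀ n, ∀ᵐ ω ∂P, ε ≤ (P[L.indicator fun _ => (1 : ℝ) | ℱ n]) ω := fun n => by
    refine ae_le_of_ae_le_trim (hm := ℱ.le n) (ae_le_of_forall_setIntegral_le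
      (f := fun _ => ε) (integrable_const _)
      (integrable_condExp.trim (ℱ.le n) stronglyMeasurable_condExp) fun A hA _ => ?_)
    rw [← setIntegral_trim (ℱ.le n) stronglyMeasurable_condExp hA,
      ← setIntegral_trim (ℱ.le n) stronglyMeasurable_const hA, setIntegral_condExp _ hLint hA,
      setIntegral_indicator hLm]
    have h := ENNReal.toReal_mono (measure_ne_top _ _) (hlower n A hA)
    rw [ENNReal.toReal_mul, ENNReal.toReal_ofReal hε.le] at h
    simpa [Measure.real, mul_comm] using h
  have hlimit : ∀ᵐ ω ∂P, Tendsto (fun n => (P[L.indicator fun _ => (1 : ℝ) | ℱ n]) ω) atTop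
      (𝓝 (L.indicator (fun _ => (1 : ℝ)) ω)) := by
    refine Integrable.tendsto_ae_condExp hLint (stronglyMeasurable_const.indicator ?_)
    have hmono : ∀ n, ℱ n ≤ ⨆ n, ℱ n := le_iSup (fun n => (ℱ n : MeasurableSpace Ω))
    have hXm : ∀ n, Measurable[⨆ n, ℱ n] (X n) := fun n =>
      (measurable_of_le_comap_pathUpTo X le_rfl).mono (hmono n) le_rfl
    exact MeasurableSet.iUnion fun K => MeasurableSet.iUnion fun _ => MeasurableSet.iUnion fun N =>
      measurableSet_steps_mem hXm K N
  filter_upwards [ae_all_iff.2 hcond, hlimit] with ω h1 h2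
  have h3 := ge_of_tendsto' h2 h1
  have hω : ω ∈ L := by
    by_contra hω
    rw [Set.indicator_of_notMem hω] at h3
    linarith
  simpa only [hL, Set.mem_iUnion, exists_prop, Set.mem_ofPred_eq] using hω

end IsGrowthProcess

/-! ### Assembly of the theorem. -/

theorem theorem1 {V : Type*} [Fintype V] [DecidableEq V] [Nontrivial V]
    (G : SimpleGraph V) [DecidableRel G.Adj] (hG : G.Connected)
    (α β : ℝ) (hα : 0 < α) (hαβ : α ≤ β)
    {Ω : Type*} [MeasurableSpace Ω] (P : Measure Ω) [IsProbabilityMeasure P]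
    (X : ℕ → Ω → V → ℕ) (hX : IsGrowthProcess G α β P X)
    (x₀ : V → ℕ) (hX₀ : ∀ᵐ ω ∂P, X 0 ω = x₀) :
    ∃ (U : Ω → Finset V) (C : V → V → Ω → ℝ),
      (∀ S : Finset V, MeasurableSet {ω | U ω = S}) ∧
      (∀ v u, Measurable (C v u)) ∧
      ∀ᵐ ω ∂P,
        Maximal G.IsClique (U ω : Set V) ∧
        (∀ v, Tendsto (fun n => X n ω v) atTop atTop ↔ v ∈ U ω) ∧
        ∀ v ∈ U ω, ∀ u ∈ U ω,
          Tendsto (fun n => (X n ω v : ℝ) / (X n ω u : ℝ)) atTop (𝓝 (Real.exp (C v u ω))) ∧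
          (α = β → Tendsto (fun n => α * neighbourDiff G (X n ω) v u) atTop (𝓝 (C v u ω))) ∧
          (α < β → C v u ω = 0) := by
  classical
  -- `U` is read off from the path and `C` is a `limsup`, so both are measurable without a
  -- measurable choice of `K` and `N`; on the almost sure event they agree with `K` and
  -- `limitLogRatio`.
  set U : Ω → Finset V := fun ω => Finset.univ.filter fun v =>
    Tendsto (fun n => X n ω v) atTop atTop with hU
  set C : V → V → Ω → ℝ := fun v u ω =>
    if α = β then limsup (fun n => α * neighbourDiff G (X n ω) v u) atTop else 0 with hC
  have hXv : ∀ n v, Measurable fun ω => X n ω v := fun n v =>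
    (measurable_pi_apply v).comp (hX.measurable n)
  refine ⟨U, C, fun S => ?_, fun v u => ?_, ?_⟩
  · have hset : {ω | U ω = S} =
        ⋂ v, {ω | Tendsto (fun n => X n ω v) atTop atTop ↔ v ∈ S} := by
      ext ω
      simp [hU, Finset.ext_iff]
    rw [hset]
    refine MeasurableSet.iInter fun v => ?_
    have hv : MeasurableSet {ω | Tendsto (fun n => X n ω v) atTop atTop} := by
      simp only [tendsto_atTop, eventually_atTop, Set.ofPred_forall, Set.ofPred_exists]
      exact MeasurableSet.iInter fun B => MeasurableSet.iUnion fun N => MeasurableSet.iInter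
        fun n => MeasurableSet.iInter fun _ => measurableSet_le measurable_const (hXv n v)
    by_cases hS : v ∈ S
    · simpa [hS] using hv
    · convert hv.compl using 1
      ext ω
      simp [hS]
  · by_cases h : α = β
    · simp only [hC, if_pos h]
      refine Measurable.limsup fun n => Measurable.const_mul ?_ _
      exact (Measurable.of_discrete (f := fun x : V → ℕ => neighbourDiff G x v u)).comp
        (hX.measurable n)
    · simp only [hC, if_neg h]
      exact measurable_const
  · filter_upwards [hX.ae_localized hα hαβ, hX.ae_tendsto_allocNoise_div]
      with ω ⟨K, hK, N, hstep⟩ hnoise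
    have hmem : ∀ v, Tendsto (fun n => X n ω v) atTop atTop ↔ v ∈ K := fun v =>
      tendsto_atTop_iff_mem (x := fun n => X n ω) hαβ hK.prop hstep hnoise
    have hUK : U ω = K := by
      ext v
      simp [hU, hmem]
    have hdiff : ∀ v ∈ K, ∀ u ∈ K,
        Tendsto (fun n => α * neighbourDiff G (X n ω) v u) atTop
          (𝓝 (α * neighbourDiff G (X N ω) v u)) := fun v hv u hu => by
      refine tendsto_const_nhds.congr' ?_
      filter_upwards [eventually_ge_atTop N] with n hn
      rw [neighbourDiff_eq_of_step_mem (x := fun n => X n ω) hK.prop hstep hv hu hn]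
    have hCeq : ∀ v ∈ K, ∀ u ∈ K, C v u ω = limitLogRatio G α β (X N ω) v u :=
      fun v hv u hu => by
        simp only [hC, limitLogRatio]
        split_ifs
        · exact (hdiff v hv u hu).limsup_eq
        · rfl
    rw [hUK]
    refine ⟨hK, hmem, fun v hv u hu => ⟨?_, fun h => ?_, fun h => ?_⟩⟩
    · rw [hCeq v hv u hu]
      exact tendsto_ratio (x := fun n => X n ω) hαβ hK.prop hstep hnoise hv hu
    · have : C v u ω = α * neighbourDiff G (X N ω) v u := by
        rw [hCeq v hv u hu, limitLogRatio, if_pos h]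
      rw [this]
      exact hdiff v hv u hu
    · simp only [hC, if_neg h.ne]
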